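/- Let $d\ge 1$, and let $\Phi:\mathbb{R}^d\to\mathbb{R}$ be a truncation function, i.e. a smooth, radially decreasing (that is, $\Phi(y)\le\Phi(x)$ whenever $|x|\le|y|$), nonnegative function supported on $\overline{B(0;2)}$ with $\Phi=1$ on $B(0;1)$. Write $\mathcal{F}[f](\xi)=\int_{\mathbb{R}^d} f(x)\,e^{-2\pi i x\cdot\xi}\,\mathrm{d}x$. Then for every real $a>4$ there exists $\eta_a>0$ such that $$\Big|\mathcal{F}\big[(|x|^a-|x|^4)\Phi(x)\big](\xi)\Big|\le \eta_a\,(1+|\xi|)^{-d-a}\qquad\text{for all }\xi\in\mathbb{R}^d.$$ Furthermore, the numbers $\eta_a$ (which may depend on $d$ and $\Phi$) can be chosen so that $\eta_a=O(a-4)$ as $a\to 4^+$. -/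

import Mathlib

open scoped ContDiff FourierTransform Topology

/-- A truncation function on `ℝ^d`: a smooth, radially decreasing, nonnegative function that is
supported on the closed ball of radius `2` and equal to `1` on the open unit ball. -/
structure IsTruncationFunction {d : ℕ} (Φ : EuclideanSpace ℝ (Fin d) → ℝ) : Prop where
  smooth : ContDiff ℝ ∞ Φ
  nonneg : ∀ x, 0 ≤ Φ x
  /-- `Φ x` is a nonincreasing function of `‖x‖`; in particular `Φ` is radial. -/
  radially_decreasing : ∀ x y, ‖x‖ ≤ ‖y‖ → Φ y ≤ Φ x
  tsupport_subset : tsupport Φ ⊆ Metric.closedBall 0 2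
  eq_one : ∀ x ∈ Metric.ball (0 : EuclideanSpace ℝ (Fin d)) 1, Φ x = 1

/-- The function `x ↦ (|x|^a - |x|^4) Φ(x)` on `ℝ^d`, regarded as complex-valued. -/
noncomputable def truncatedPowerDiff {d : ℕ} (Φ : EuclideanSpace ℝ (Fin d) → ℝ) (a : ℝ) :
    EuclideanSpace ℝ (Fin d) → ℂ :=
  fun x => (((‖x‖ ^ a - ‖x‖ ^ 4) * Φ x : ℝ) : ℂ)

/-! ### Dyadic recursion and elementary inequalities. -/

open MeasureTheory

/-! Only the origin limits the smoothness of `f = (|x|^a - |x|^4) Φ`, and there `f` is a difference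
of homogeneous functions. Comparing `f` with its dilate gives (`truncatedPowerDiff_dyadic`) `f(x) =
2^(-a) f(2x) + (2^(-a) - 2^(-4)) Q(2x) + B(x)`, where `Q = |x|^4 Φ` is smooth and `B` is a
difference of blocks `|x|^a (Φ(x) - Φ(2x))` at exponents `a` and `4`, smooth because they vanish
near the origin.

On the Fourier side, `h(ξ) = 2^(-d-a) h(ξ/2)` up to an error that decays faster than `|ξ|^(-d-a)`.
The error carries a factor `a - 4`: in the coefficient of `Q`, and in `B` by smooth dependence on
the exponent. So does the sup bound on `h`. Iterating down to `|ξ| ≤ 1`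
(`norm_le_of_dyadic_recursion`) yields the decay with a constant linear in `a - 4`. -/

/-- A function that almost satisfies the homogeneity relation `h (ξ) = 2 ^ (-p) h (ξ / 2)` for
`‖ξ‖ ≥ 1` decays like `‖ξ‖ ^ (-p)`. -/
theorem norm_le_of_dyadic_recursion {V F : Type*} [NormedAddCommGroup V] [NormedSpace ℝ V]
    [NormedAddCommGroup F] {h : V → F} {p D : ℝ} (hp : 0 ≤ p) (hD : 0 ≤ D)
    (hbdd : ∀ ξ, ‖h ξ‖ ≤ D)
    (hrec : ∀ ξ, 1 ≤ ‖ξ‖ →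
      ‖h ξ‖ ≤ 2 ^ (-p) * ‖h ((1 / 2 : ℝ) • ξ)‖ + D * ‖ξ‖ ^ (-p - 1)) (ξ : V) :
    ‖h ξ‖ ≤ 3 * D * 2 ^ p * (1 + ‖ξ‖) ^ (-p) := by
  -- The term `-D / ‖ξ‖` makes the induction close: passing from `ξ / 2` to `ξ` changes it from `-2D
  -- / ‖ξ‖` to `-D / ‖ξ‖`, which is exactly the error `D / ‖ξ‖` of one step.
  have low : ∀ ξ : V, 1 / 2 ≤ ‖ξ‖ → ‖ξ‖ ≤ 1 → ‖ξ‖ ^ p * ‖h ξ‖ ≤ 3 * D - D / ‖ξ‖ := by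
    intro ξ h1 h2
    have h3 : ‖ξ‖ ^ p ≤ 1 := Real.rpow_le_one (norm_nonneg _) h2 hp
    have h4 : D / ‖ξ‖ ≤ 2 * D := by
      rw [div_le_iff₀ (by linarith)]
      nlinarith
    have h5 : ‖ξ‖ ^ p * ‖h ξ‖ ≤ 1 * D := by
      gcongr
      exact hbdd ξ
    linarith
  have key : ∀ n : ℕ, ∀ ξ : V, 1 / 2 ≤ ‖ξ‖ → ‖ξ‖ ≤ 2 ^ n →
      ‖ξ‖ ^ p * ‖h ξ‖ ≤ 3 * D - D / ‖ξ‖ := by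
    intro n
    induction n with
    | zero => simpa using low
    | succ n ih =>
      intro ξ h1 h2
      rcases le_total ‖ξ‖ 1 with h3 | h3
      · exact low ξ h1 h3
      have hpos : 0 < ‖ξ‖ := by linarith
      have hn : ‖(1 / 2 : ℝ) • ξ‖ = ‖ξ‖ / 2 := by
        rw [norm_smul]
        norm_num
        ring
      have h4 := ih ((1 / 2 : ℝ) • ξ) (by rw [hn]; linarith)
        (by rw [hn]; rw [pow_succ] at h2; linarith)
      rw [hn, Real.div_rpow hpos.le (by norm_num)] at h4
      have h5 := mul_le_mul_of_nonneg_left (hrec ξ h3) (Real.rpow_nonneg hpos.le p)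
      have h6 : ‖ξ‖ ^ p * ‖ξ‖ ^ (-p - 1) = 1 / ‖ξ‖ := by
        rw [← Real.rpow_add hpos, show p + (-p - 1) = -1 by ring, Real.rpow_neg_one, one_div]
      have h7 : ‖ξ‖ ^ p * (2 ^ (-p) * ‖h ((1 / 2 : ℝ) • ξ)‖ + D * ‖ξ‖ ^ (-p - 1)) =
          ‖ξ‖ ^ p / 2 ^ p * ‖h ((1 / 2 : ℝ) • ξ)‖ + D * (‖ξ‖ ^ p * ‖ξ‖ ^ (-p - 1)) := by
        rw [Real.rpow_neg (by norm_num)]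
        ring
      rw [h7, h6] at h5
      have h8 : D / (‖ξ‖ / 2) = D / ‖ξ‖ + D * (1 / ‖ξ‖) := by
        field_simp
        ring
      linarith
  rcases le_total ‖ξ‖ 1 with h1 | h1
  · have h2 : 2 ^ (-p) ≤ (1 + ‖ξ‖) ^ (-p) :=
      Real.rpow_le_rpow_of_nonpos (by positivity) (by linarith) (by linarith)
    have h3 : (2 : ℝ) ^ p * 2 ^ (-p) = 1 := by
      rw [← Real.rpow_add (by norm_num)]
      simp
    calc ‖h ξ‖ ≤ D := hbdd ξ
      _ ≤ 3 * D * (2 ^ p * 2 ^ (-p)) := by rw [h3]; linarith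
      _ ≤ 3 * D * (2 ^ p * (1 + ‖ξ‖) ^ (-p)) := by gcongr
      _ = _ := by ring
  · have hpos : 0 < ‖ξ‖ := by linarith
    obtain ⟨n, hn⟩ := pow_unbounded_of_one_lt ‖ξ‖ (by norm_num : (1 : ℝ) < 2)
    have h2 := key n ξ (by linarith) hn.le
    have h3 : (2 * ‖ξ‖) ^ (-p) ≤ (1 + ‖ξ‖) ^ (-p) :=
      Real.rpow_le_rpow_of_nonpos (by positivity) (by linarith) (by linarith)
    have h4 : ‖h ξ‖ = 2 ^ p * (2 * ‖ξ‖) ^ (-p) * (‖ξ‖ ^ p * ‖h ξ‖) := by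
      rw [Real.mul_rpow (by norm_num) hpos.le, Real.rpow_neg (by norm_num), Real.rpow_neg hpos.le]
      field_simp
    have h5 : 0 ≤ D / ‖ξ‖ := by positivity
    calc ‖h ξ‖ = 2 ^ p * (2 * ‖ξ‖) ^ (-p) * (‖ξ‖ ^ p * ‖h ξ‖) := h4
      _ ≤ 2 ^ p * (1 + ‖ξ‖) ^ (-p) * (3 * D) := by
        have h6 : ‖ξ‖ ^ p * ‖h ξ‖ ≤ 3 * D := by linarith
        gcongr
      _ = _ := by ring

/-- On `[0, 2]` the powers `t ^ a` are Lipschitz in the exponent at `a = 4`. -/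
theorem abs_rpow_sub_pow_four_le {t a : ℝ} (ht : 0 ≤ t) (ht2 : t ≤ 2) (ha : 4 < a) :
    |t ^ a - t ^ 4| ≤ 2 ^ a * (a - 4) := by
  have h2a : (1 : ℝ) ≤ 2 ^ a := Real.one_le_rpow (by norm_num) (by linarith)
  rcases ht.eq_or_lt with rfl | hpos
  · rw [Real.zero_rpow (by linarith)]
    simp only [ne_eq, OfNat.ofNat_ne_zero, not_false_eq_true, zero_pow, sub_self, abs_zero]
    exact mul_nonneg (by linarith) (by linarith)
  rcases le_total t 1 with h1 | h1
  · have h3 : t ^ a = t ^ 4 * Real.exp (Real.log t * (a - 4)) := by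
      rw [← Real.rpow_def_of_pos hpos, ← Real.rpow_natCast, ← Real.rpow_add hpos]
      norm_num
    have h4 := Real.add_one_le_exp (Real.log t * (a - 4))
    have h5 : t ^ a ≤ t ^ 4 := by
      rw [← Real.rpow_natCast]
      exact Real.rpow_le_rpow_of_exponent_ge hpos h1 (by norm_num; linarith)
    have h6 : -Real.log t ≤ t⁻¹ - 1 := by
      rw [← Real.log_inv]
      exact Real.log_le_sub_one_of_pos (by positivity)
    have h7 : t ^ 4 * (-Real.log t) ≤ 1 := by
      calc t ^ 4 * (-Real.log t) ≤ t ^ 4 * (t⁻¹ - 1) := by gcongr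
        _ = t ^ 3 - t ^ 4 := by field_simp
        _ ≤ 1 := by
          have := pow_le_one₀ (n := 3) ht h1
          have : 0 ≤ t ^ 4 := by positivity
          linarith
    rw [abs_of_nonpos (by linarith), h3]
    calc -(t ^ 4 * Real.exp (Real.log t * (a - 4)) - t ^ 4)
        = t ^ 4 * (1 - Real.exp (Real.log t * (a - 4))) := by ring
      _ ≤ t ^ 4 * (-(Real.log t * (a - 4))) := by gcongr; linarith
      _ = t ^ 4 * (-Real.log t) * (a - 4) := by ring
      _ ≤ 1 * (a - 4) := mul_le_mul_of_nonneg_right h7 (by linarith)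
      _ ≤ _ := mul_le_mul_of_nonneg_right h2a (by linarith)
  · have h3 : t ^ 4 = t ^ a * Real.exp (Real.log t * (4 - a)) := by
      rw [← Real.rpow_def_of_pos hpos, ← Real.rpow_natCast, ← Real.rpow_add hpos]
      norm_num
    have h4 := Real.add_one_le_exp (Real.log t * (4 - a))
    have h5 : t ^ 4 ≤ t ^ a := by
      rw [← Real.rpow_natCast]
      exact Real.rpow_le_rpow_of_exponent_le h1 (by norm_num; linarith)
    have h6 : Real.log t ≤ 1 := by
      have := Real.log_le_sub_one_of_pos hpos
      linarith
    have h7 : 0 ≤ t ^ a := by positivity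
    rw [abs_of_nonneg (by linarith), h3]
    calc t ^ a - t ^ a * Real.exp (Real.log t * (4 - a))
        = t ^ a * (1 - Real.exp (Real.log t * (4 - a))) := by ring
      _ ≤ t ^ a * (Real.log t * (a - 4)) := by gcongr; linarith
      _ ≤ 2 ^ a * (1 * (a - 4)) := by
        gcongr
        exact mul_nonneg (Real.log_nonneg h1) (by linarith)
      _ = _ := by ring

theorem abs_two_rpow_neg_sub_le {a : ℝ} (ha : 4 < a) :
    |(2 : ℝ) ^ (-a) - 2 ^ (-4 : ℝ)| ≤ a - 4 := by
  have h1 : (2 : ℝ) ^ (-a) = 2 ^ (-4 : ℝ) * Real.exp (Real.log 2 * (4 - a)) := by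
    rw [← Real.rpow_def_of_pos (by norm_num), ← Real.rpow_add (by norm_num)]
    ring_nf
  have h2 := Real.add_one_le_exp (Real.log 2 * (4 - a))
  have h3 : Real.exp (Real.log 2 * (4 - a)) ≤ 1 :=
    Real.exp_le_one_iff.2 (mul_nonpos_of_nonneg_of_nonpos (Real.log_nonneg (by norm_num))
      (by linarith))
  have h4 : Real.log 2 ≤ 1 := by
    have := Real.log_le_sub_one_of_pos (by norm_num : (0 : ℝ) < 2)
    linarith
  have h5 : (2 : ℝ) ^ (-4 : ℝ) ≤ 1 :=
    Real.rpow_le_one_of_one_le_of_nonpos (by norm_num) (by norm_num)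
  have h6 : (0 : ℝ) ≤ 2 ^ (-4 : ℝ) := by positivity
  rw [h1, abs_of_nonpos (by nlinarith)]
  nlinarith

/-! ### Fourier transform bounds for compactly supported functions. -/

section Fourier

variable {V : Type*} [NormedAddCommGroup V] [InnerProductSpace ℝ V] [FiniteDimensional ℝ V]
  [MeasurableSpace V] [BorelSpace V]

theorem fourier_comp_two_smul (f : V → ℂ) (ξ : V) :
    𝓕 (fun x => f ((2 : ℝ) • x)) ξ =
      ((2 : ℝ) ^ (-(Module.finrank ℝ V : ℝ)) : ℝ) • 𝓕 f ((1 / 2 : ℝ) • ξ) := by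
  rw [Real.fourier_eq, Real.fourier_eq]
  have := Measure.integral_comp_smul (volume : Measure V)
    (fun v => 𝐞 (-inner ℝ v ((1 / 2 : ℝ) • ξ)) • f v) 2
  rw [abs_of_nonneg (by positivity), ← Real.rpow_natCast, ← Real.rpow_neg (by norm_num)] at this
  rw [← this]
  congr 1
  ext v
  rw [inner_smul_left, inner_smul_right]
  simp

theorem norm_fourier_le_of_bounded {f : V → ℂ} {R B : ℝ}
    (hsupp : Function.support f ⊆ Metric.closedBall 0 R) (hB : ∀ x, ‖f x‖ ≤ B) (ξ : V) :
    ‖𝓕 f ξ‖ ≤ volume.real (Metric.closedBall (0 : V) R) * B := by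
  have h1 : ‖𝓕 f ξ‖ ≤ ∫ x, ‖f x‖ :=
    VectorFourier.norm_fourierIntegral_le_integral_norm _ _ _ _ _
  have h2 : ∫ x, ‖f x‖ = ∫ x in Metric.closedBall (0 : V) R, ‖f x‖ := by
    rw [setIntegral_eq_integral_of_forall_compl_eq_zero]
    intro x hx
    by_contra hne
    exact hx (hsupp (fun h0 => hne (by simp [h0])))
  have h3 : ‖∫ x in Metric.closedBall (0 : V) R, ‖f x‖‖ ≤
      B * volume.real (Metric.closedBall (0 : V) R) :=
    norm_setIntegral_le_of_norm_le_const (measure_closedBall_lt_top) (fun x _ => by simpa using hB x)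
  rw [mul_comm, ← h2] at h3
  rw [mul_comm]
  have := le_abs_self (∫ x, ‖f x‖)
  rw [Real.norm_eq_abs] at h3
  linarith

/-- Integration by parts. Linearity in `B` lets a factor `a - 4` in the derivatives pass to the
transform. -/
theorem pow_mul_norm_fourier_le_of_iteratedFDeriv_le {f : V → ℂ} {R B : ℝ} {n : ℕ}
    (hf : ContDiff ℝ ∞ f) (hsupp : tsupport f ⊆ Metric.closedBall 0 R)
    (hB : ∀ j ≤ n, ∀ x ∈ Metric.closedBall (0 : V) R, ‖iteratedFDeriv ℝ j f x‖ ≤ B) (ξ : V) :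
    ‖ξ‖ ^ n * ‖𝓕 f ξ‖ ≤
      2 ^ n * ((n + 1) * volume.real (Metric.closedBall (0 : V) R)) * B := by
  have hc : HasCompactSupport f :=
    (isCompact_closedBall (0 : V) R).of_isClosed_subset (isClosed_tsupport f) hsupp
  have hint : ∀ k m : ℕ, (k : ℕ∞) ≤ 0 → (m : ℕ∞) ≤ (⊤ : ℕ∞) →
      Integrable (fun v ↦ ‖v‖ ^ k * ‖iteratedFDeriv ℝ m f v‖) := by
    intro k m _ _
    have hcont : Continuous (iteratedFDeriv ℝ m f) :=
      hf.continuous_iteratedFDeriv (by exact_mod_cast le_top)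
    exact Continuous.integrable_of_hasCompactSupport (by fun_prop)
      ((hc.iteratedFDeriv m).norm.mul_left)
  have h1 := Real.pow_mul_norm_iteratedFDeriv_fourier_le (K := 0) (N := ⊤) hf hint
    (k := 0) (n := n) (by simp) le_top ξ
  rw [norm_iteratedFDeriv_zero] at h1
  refine h1.trans ?_
  have h2 : ∀ j ≤ n, ∫ v, ‖iteratedFDeriv ℝ j f v‖ ≤
      B * volume.real (Metric.closedBall (0 : V) R) := by
    intro j hj
    have h3 : ∫ x, ‖iteratedFDeriv ℝ j f x‖ =
        ∫ x in Metric.closedBall (0 : V) R, ‖iteratedFDeriv ℝ j f x‖ := by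
      rw [setIntegral_eq_integral_of_forall_compl_eq_zero]
      intro x hx
      by_contra hne
      exact hx (hsupp (support_iteratedFDeriv_subset (𝕜 := ℝ) j (fun h0 => hne (by rw [h0, norm_zero]))))
    rw [h3]
    refine (le_abs_self _).trans ?_
    exact norm_setIntegral_le_of_norm_le_const (f := fun x => ‖iteratedFDeriv ℝ j f x‖)
      measure_closedBall_lt_top (fun x hx => by simpa using hB j hj x hx)
  have h4 : ∑ p ∈ Finset.range (0 + 1) ×ˢ Finset.range (n + 1),
      ∫ v, ‖v‖ ^ p.1 * ‖iteratedFDeriv ℝ p.2 f v‖ ≤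
      ∑ p ∈ Finset.range (0 + 1) ×ˢ Finset.range (n + 1),
        B * volume.real (Metric.closedBall (0 : V) R) := by
    refine Finset.sum_le_sum fun p hp => ?_
    simp only [Finset.mem_product, Finset.mem_range] at hp
    have : p.1 = 0 := by omega
    simpa [this] using h2 p.2 (by omega)
  simp only [Finset.sum_const, Finset.card_product, Finset.card_range, nsmul_eq_mul] at h4
  calc _ ≤ (2 * Real.pi) ^ 0 * (2 * ((0 : ℕ) : ℝ) + 2) ^ n *
        (((0 + 1) * (n + 1) : ℕ) * (B * volume.real (Metric.closedBall (0 : V) R))) := by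
        gcongr
    _ = _ := by push_cast; ring

theorem exists_pow_mul_norm_fourier_le {f : V → ℂ} {R : ℝ} (hf : ContDiff ℝ ∞ f)
    (hsupp : tsupport f ⊆ Metric.closedBall 0 R) (n : ℕ) :
    ∃ C, 0 ≤ C ∧ ∀ ξ, ‖ξ‖ ^ n * ‖𝓕 f ξ‖ ≤ C := by
  have h1 : ∀ j : ℕ, ∃ C, ∀ x ∈ Metric.closedBall (0 : V) R, ‖iteratedFDeriv ℝ j f x‖ ≤ C :=
    fun j => (isCompact_closedBall (0 : V) R).exists_bound_of_continuousOn
      (hf.continuous_iteratedFDeriv (by exact_mod_cast le_top)).continuousOn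
  choose C hC using h1
  refine ⟨_, ?_, pow_mul_norm_fourier_le_of_iteratedFDeriv_le (B := ∑ j ∈ Finset.range (n + 1), |C j|)
    hf hsupp fun j hj x hx => ?_⟩
  · positivity
  · exact ((hC j x hx).trans (le_abs_self _)).trans
      (Finset.single_le_sum (f := fun j => |C j|) (fun _ _ => abs_nonneg _)
        (Finset.mem_range.2 (by omega)))

end Fourier

/-! ### Smooth dependence on a parameter. -/

section Parameter

variable {V : Type*} [NormedAddCommGroup V] [NormedSpace ℝ V]

/-- Derivatives of a slice are joint derivatives restricted along the inclusion `y ↦ (0, y)`, which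
has norm at most one. -/
theorem norm_iteratedFDeriv_slice_sub_le {K : ℝ × V → ℂ} (hK : ContDiff ℝ ∞ K) (j : ℕ)
    (a b : ℝ) (x : V) :
    ‖iteratedFDeriv ℝ j (fun y => K (a, y) - K (b, y)) x‖ ≤
      ‖iteratedFDeriv ℝ j K (a, x) - iteratedFDeriv ℝ j K (b, x)‖ := by
  have slice : ∀ c : ℝ, iteratedFDeriv ℝ j (fun y => K (c, y)) x =
      (iteratedFDeriv ℝ j K (c, x)).compContinuousLinearMap
        fun _ => ContinuousLinearMap.inr ℝ ℝ V := by
    intro c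
    have h1 : (fun y => K (c, y)) =
        (fun z => K (z + (c, 0))) ∘ (ContinuousLinearMap.inr ℝ ℝ V) := by
      ext y
      simp
    have h2 : ContDiff ℝ ∞ (fun z => K (z + (c, 0))) :=
      hK.comp (contDiff_id.add contDiff_const)
    rw [h1, ContinuousLinearMap.iteratedFDeriv_comp_right _ h2 x (by exact_mod_cast le_top),
      iteratedFDeriv_comp_add_right]
    simp
  have hs : ∀ c : ℝ, ContDiff ℝ ∞ (fun y => K (c, y)) := fun c =>
    hK.comp (contDiff_const.prodMk contDiff_id)
  have hle : ((j : ℕ) : WithTop ℕ∞) ≤ ∞ := by exact_mod_cast le_top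
  have h2 : iteratedFDeriv ℝ j (fun y => K (a, y) - K (b, y)) x =
      (iteratedFDeriv ℝ j K (a, x) - iteratedFDeriv ℝ j K (b, x)).compContinuousLinearMap
        fun _ => ContinuousLinearMap.inr ℝ ℝ V := by
    have := iteratedFDeriv_sub_apply (x := x) ((hs a).of_le hle).contDiffAt
      ((hs b).of_le hle).contDiffAt
    rw [slice a, slice b] at this
    exact this
  rw [h2]
  refine (ContinuousMultilinearMap.norm_compContinuousLinearMap_le _ _).trans ?_
  refine mul_le_of_le_one_right (norm_nonneg _) (Finset.prod_le_one (fun _ _ => norm_nonneg _)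
    fun _ _ => ContinuousLinearMap.norm_inr_le_one _ _ _)

/-- Smooth dependence on a parameter, uniformly on compact sets. -/
theorem exists_norm_iteratedFDeriv_slice_sub_le [FiniteDimensional ℝ V] {K : ℝ × V → ℂ} (hK : ContDiff ℝ ∞ K)
    (b A R : ℝ) (n : ℕ) :
    ∃ C, 0 ≤ C ∧ ∀ a, b ≤ a → a ≤ A → ∀ j ≤ n, ∀ x ∈ Metric.closedBall (0 : V) R,
      ‖iteratedFDeriv ℝ j (fun y => K (a, y) - K (b, y)) x‖ ≤ C * (a - b) := by
  have hsm : ∀ j : ℕ, ContDiff ℝ ∞ (iteratedFDeriv ℝ j K) := fun j =>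
    hK.iteratedFDeriv_right (m := ∞) (i := j) (by exact_mod_cast le_top)
  have h1 : ∀ j : ℕ, ∃ C, ∀ z ∈ Set.Icc b A ×ˢ Metric.closedBall (0 : V) R,
      ‖fderiv ℝ (iteratedFDeriv ℝ j K) z‖ ≤ C := fun j =>
    (isCompact_Icc.prod (isCompact_closedBall (0 : V) R)).exists_bound_of_continuousOn
      ((hsm j).continuous_fderiv (by simp)).continuousOn
  choose C hC using h1
  refine ⟨∑ j ∈ Finset.range (n + 1), |C j|, by positivity, fun a ha haA j hj x hx => ?_⟩
  refine (norm_iteratedFDeriv_slice_sub_le hK j a b x).trans ?_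
  -- Mean value inequality along the segment from `(b, x)` to `(a, x)`.
  have h2 := (convex_Icc b A |>.prod (convex_closedBall (0 : V) R)).norm_image_sub_le_of_norm_fderiv_le
    (fun z _ => ((hsm j).differentiable (by simp)).differentiableAt) (hC j)
    (x := (b, x)) (y := (a, x)) ⟨⟨le_rfl, ha.trans haA⟩, hx⟩ ⟨⟨ha, haA⟩, hx⟩
  refine h2.trans ?_
  have h3 : ‖((a, x) : ℝ × V) - (b, x)‖ = a - b := by
    simp [Prod.norm_def, abs_of_nonneg (sub_nonneg.2 ha), ha]
  rw [h3]
  refine mul_le_mul_of_nonneg_right ?_ (sub_nonneg.2 ha)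
  exact (le_abs_self _).trans (Finset.single_le_sum (f := fun j => |C j|)
    (fun _ _ => abs_nonneg _) (Finset.mem_range.2 (by omega)))

end Parameter

/-! ### Dyadic decomposition of the truncated power and the uniform estimate. -/

section TruncatedPower

variable {d : ℕ} {Φ : EuclideanSpace ℝ (Fin d) → ℝ}

/-- The smooth dyadic block `|x| ^ a (Φ (x) - Φ (2 x))`, as a function of the pair `(a, x)`. -/
noncomputable def dyadicPowerBlock (Φ : EuclideanSpace ℝ (Fin d) → ℝ)
    (z : ℝ × EuclideanSpace ℝ (Fin d)) : ℂ :=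
  ((‖z.2‖ ^ z.1 * (Φ z.2 - Φ ((2 : ℝ) • z.2)) : ℝ) : ℂ)

/-- The function `|x| ^ 4 Φ (x)`. -/
noncomputable def truncatedQuartic (Φ : EuclideanSpace ℝ (Fin d) → ℝ)
    (x : EuclideanSpace ℝ (Fin d)) : ℂ :=
  ((‖x‖ ^ 4 * Φ x : ℝ) : ℂ)

theorem IsTruncationFunction.eq_zero (hΦ : IsTruncationFunction Φ)
    {x : EuclideanSpace ℝ (Fin d)} (hx : 2 < ‖x‖) : Φ x = 0 := by
  by_contra h
  have := hΦ.tsupport_subset (subset_tsupport Φ h)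
  simp only [mem_closedBall_zero_iff] at this
  linarith

theorem IsTruncationFunction.le_one (hΦ : IsTruncationFunction Φ)
    (x : EuclideanSpace ℝ (Fin d)) : Φ x ≤ 1 := by
  have h1 : Φ 0 = 1 := hΦ.eq_one 0 (by simp)
  rw [← h1]
  exact hΦ.radially_decreasing 0 x (by simp)

/-- For `‖x‖ < 1 / 2` both cutoffs equal `1` and cancel; away from the origin the norm is smooth and
positive. -/
theorem contDiff_dyadicPowerBlock (hΦ : IsTruncationFunction Φ) :
    ContDiff ℝ ∞ (dyadicPowerBlock Φ) := by
  have hsm := hΦ.smooth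
  rw [contDiff_iff_contDiffAt]
  intro z
  by_cases hz : z.2 = 0
  · have h1 : dyadicPowerBlock Φ =ᶠ[𝓝 z] fun _ => 0 := by
      have h2 : ∀ᶠ w in 𝓝 z, ‖w.2‖ < 1 / 2 := by
        have : Continuous fun w : ℝ × EuclideanSpace ℝ (Fin d) => ‖w.2‖ := by fun_prop
        exact this.continuousAt.eventually_lt_const (by simp [hz])
      filter_upwards [h2] with w hw
      have h3 : Φ w.2 = 1 := hΦ.eq_one _ (by simp; linarith)
      have h4 : Φ ((2 : ℝ) • w.2) = 1 := hΦ.eq_one _ (by simp [norm_smul]; linarith)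
      simp [dyadicPowerBlock, h3, h4]
    exact contDiffAt_const.congr_of_eventuallyEq h1
  · have h1 : ContDiffAt ℝ ∞ (fun w : ℝ × EuclideanSpace ℝ (Fin d) => ‖w.2‖ ^ w.1) z :=
      ContDiffAt.rpow (contDiffAt_snd.norm ℝ hz) contDiffAt_fst (by simpa using hz)
    have h2 : ContDiff ℝ ∞ (fun w : ℝ × EuclideanSpace ℝ (Fin d) =>
        Φ w.2 - Φ ((2 : ℝ) • w.2)) := by fun_prop
    exact Complex.ofRealCLM.contDiff.contDiffAt.comp z (h1.mul h2.contDiffAt)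

theorem contDiff_truncatedQuartic (hΦ : IsTruncationFunction Φ) :
    ContDiff ℝ ∞ (truncatedQuartic Φ) := by
  have h1 : ContDiff ℝ ∞ (fun x : EuclideanSpace ℝ (Fin d) => ‖x‖ ^ 4 * Φ x) := by
    have h2 : (fun x : EuclideanSpace ℝ (Fin d) => ‖x‖ ^ 4 * Φ x) =
        fun x => (‖x‖ ^ 2) ^ 2 * Φ x := by
      ext x
      ring
    rw [h2]
    exact ((contDiff_norm_sq ℝ).pow 2).mul hΦ.smooth
  exact Complex.ofRealCLM.contDiff.comp h1

theorem tsupport_truncatedQuartic_subset (hΦ : IsTruncationFunction Φ) :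
    tsupport (truncatedQuartic Φ) ⊆ Metric.closedBall 0 2 := by
  refine closure_minimal (fun x hx => ?_) Metric.isClosed_closedBall
  by_contra h
  exact hx (by simp [truncatedQuartic, hΦ.eq_zero (by simpa using h)])

theorem tsupport_dyadicPowerBlock_sub_subset (hΦ : IsTruncationFunction Φ) (a b : ℝ) :
    tsupport (fun x => dyadicPowerBlock Φ (a, x) - dyadicPowerBlock Φ (b, x)) ⊆
      Metric.closedBall 0 2 := by
  refine closure_minimal (fun x hx => ?_) Metric.isClosed_closedBall
  by_contra h
  have h1 : 2 < ‖x‖ := by simpa using h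
  have h2 : 2 < ‖(2 : ℝ) • x‖ := by
    rw [norm_smul, Real.norm_ofNat]
    linarith
  exact hx (by simp [dyadicPowerBlock, hΦ.eq_zero h1, hΦ.eq_zero h2])

theorem support_truncatedPowerDiff_subset (hΦ : IsTruncationFunction Φ) (a : ℝ) :
    Function.support (truncatedPowerDiff Φ a) ⊆ Metric.closedBall 0 2 := by
  intro x hx
  by_contra h
  exact hx (by simp [truncatedPowerDiff, hΦ.eq_zero (by simpa using h)])

theorem continuous_truncatedPowerDiff (hΦ : IsTruncationFunction Φ) {a : ℝ} (ha : 4 < a) :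
    Continuous (truncatedPowerDiff Φ a) := by
  have h1 : Continuous fun x : EuclideanSpace ℝ (Fin d) => ‖x‖ ^ a :=
    continuous_norm.rpow_const fun _ => Or.inr (by linarith)
  have h2 := hΦ.smooth.continuous
  unfold truncatedPowerDiff
  fun_prop

theorem norm_truncatedPowerDiff_le (hΦ : IsTruncationFunction Φ) {a : ℝ} (ha : 4 < a)
    (x : EuclideanSpace ℝ (Fin d)) : ‖truncatedPowerDiff Φ a x‖ ≤ 2 ^ a * (a - 4) := by
  have h0 : 0 ≤ 2 ^ a * (a - 4) := mul_nonneg (by positivity) (by linarith)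
  rcases le_or_gt ‖x‖ 2 with h | h
  · rw [truncatedPowerDiff, Complex.norm_real, Real.norm_eq_abs, abs_mul,
      abs_of_nonneg (hΦ.nonneg x)]
    have h1 := abs_rpow_sub_pow_four_le (norm_nonneg x) h ha
    have h2 := hΦ.le_one x
    calc _ ≤ 2 ^ a * (a - 4) * 1 := mul_le_mul h1 h2 (hΦ.nonneg x) h0
      _ = _ := mul_one _
  · simpa [truncatedPowerDiff, hΦ.eq_zero h] using h0

theorem truncatedPowerDiff_dyadic {a : ℝ} (x : EuclideanSpace ℝ (Fin d)) :
    truncatedPowerDiff Φ a x =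
      (((2 : ℝ) ^ (-a) : ℝ) • truncatedPowerDiff Φ a ((2 : ℝ) • x) +
        ((2 : ℝ) ^ (-a) - 2 ^ (-4 : ℝ) : ℝ) • truncatedQuartic Φ ((2 : ℝ) • x)) +
        (dyadicPowerBlock Φ (a, x) - dyadicPowerBlock Φ (4, x)) := by
  have h1 : ‖(2 : ℝ) • x‖ = 2 * ‖x‖ := by simp [norm_smul]
  have h2 : (2 : ℝ) ^ a ≠ 0 := by positivity
  have h3 : (2 : ℝ) ^ (-4 : ℝ) = 1 / 16 := by
    rw [Real.rpow_neg (by norm_num)]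
    norm_num
  have h4 : ‖x‖ ^ (4 : ℝ) = ‖x‖ ^ 4 := by exact_mod_cast Real.rpow_natCast ‖x‖ 4
  simp only [truncatedPowerDiff, truncatedQuartic, dyadicPowerBlock, Complex.real_smul, h1, h3, h4,
    ← Complex.ofReal_mul, ← Complex.ofReal_add, ← Complex.ofReal_sub]
  rw [Real.mul_rpow (by norm_num) (norm_nonneg x), Real.rpow_neg (by norm_num)]
  congr 1
  field_simp
  ring

theorem fourier_truncatedPowerDiff_dyadic (hΦ : IsTruncationFunction Φ) {a : ℝ} (ha : 4 < a)
    (ξ : EuclideanSpace ℝ (Fin d)) :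
    𝓕 (truncatedPowerDiff Φ a) ξ =
      (((2 : ℝ) ^ (-a) * 2 ^ (-(d : ℝ)) : ℝ) • 𝓕 (truncatedPowerDiff Φ a) ((1 / 2 : ℝ) • ξ) +
        (((2 : ℝ) ^ (-a) - 2 ^ (-4 : ℝ)) * 2 ^ (-(d : ℝ)) : ℝ) •
          𝓕 (truncatedQuartic Φ) ((1 / 2 : ℝ) • ξ)) +
        𝓕 (fun x => dyadicPowerBlock Φ (a, x) - dyadicPowerBlock Φ (4, x)) ξ := by
  have compact : ∀ {f : EuclideanSpace ℝ (Fin d) → ℂ},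
      tsupport f ⊆ Metric.closedBall 0 2 → HasCompactSupport f := fun h =>
    (isCompact_closedBall _ _).of_isClosed_subset (isClosed_tsupport _) h
  have i1 : Integrable (truncatedPowerDiff Φ a) :=
    (continuous_truncatedPowerDiff hΦ ha).integrable_of_hasCompactSupport
      (compact (closure_minimal (support_truncatedPowerDiff_subset hΦ a)
        Metric.isClosed_closedBall))
  have i2 : Integrable (truncatedQuartic Φ) :=
    (contDiff_truncatedQuartic hΦ).continuous.integrable_of_hasCompactSupport
      (compact (tsupport_truncatedQuartic_subset hΦ))
  have i3 : Integrable (fun x => dyadicPowerBlock Φ (a, x) - dyadicPowerBlock Φ (4, x)) := by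
    have := (contDiff_dyadicPowerBlock hΦ).continuous
    exact Continuous.integrable_of_hasCompactSupport (by fun_prop)
      (compact (tsupport_dyadicPowerBlock_sub_subset hΦ a 4))
  have j1 := i1.comp_smul (two_ne_zero' ℝ)
  have j2 := i2.comp_smul (two_ne_zero' ℝ)
  have h0 : truncatedPowerDiff Φ a =
      (((2 : ℝ) ^ (-a) : ℝ) • (fun x => truncatedPowerDiff Φ a ((2 : ℝ) • x)) +
        ((2 : ℝ) ^ (-a) - 2 ^ (-4 : ℝ) : ℝ) • (fun x => truncatedQuartic Φ ((2 : ℝ) • x))) +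
        (fun x => dyadicPowerBlock Φ (a, x) - dyadicPowerBlock Φ (4, x)) :=
    funext truncatedPowerDiff_dyadic
  have add : ∀ {f g : EuclideanSpace ℝ (Fin d) → ℂ}, Integrable f → Integrable g →
      𝓕 (f + g) ξ = 𝓕 f ξ + 𝓕 g ξ := by
    intro f g hf hg
    have := VectorFourier.fourierIntegral_add (e := Real.fourierChar) (L := innerₗ _)
      Real.continuous_fourierChar (by exact continuous_inner) hf hg
    exact congrFun this ξ
  have smul : ∀ (c : ℝ) (f : EuclideanSpace ℝ (Fin d) → ℂ), 𝓕 (c • f) ξ = c • 𝓕 f ξ := by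
    intro c f
    simp only [Real.fourier_eq, Pi.smul_apply]
    rw [← integral_smul]
    congr 1
    ext v
    rw [smul_comm]
  conv_lhs => rw [h0]
  rw [add ((j1.smul _).add (j2.smul _)) i3, add (j1.smul _) (j2.smul _), smul, smul,
    fourier_comp_two_smul, fourier_comp_two_smul, smul_smul, smul_smul]
  simp

/-- The decay estimate, with a constant that is uniform for exponents in `(4, A]`. -/
theorem exists_norm_fourier_truncatedPowerDiff_le (hΦ : IsTruncationFunction Φ) (A : ℝ) :
    ∃ C, 0 < C ∧ ∀ a, 4 < a → a ≤ A → ∀ ξ : EuclideanSpace ℝ (Fin d),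
      ‖𝓕 (truncatedPowerDiff Φ a) ξ‖ ≤ C * (a - 4) * (1 + ‖ξ‖) ^ (-(d : ℝ) - a) := by
  -- With this `n`, `‖ξ‖ ^ (-n)` is at most `‖ξ‖ ^ (-(d + a) - 1)` for all `a ≤ A` and `‖ξ‖ ≥ 1`.
  obtain ⟨n, hn⟩ := exists_nat_ge (d + A + 1)
  obtain ⟨C₁, hC₁, h₁⟩ := exists_pow_mul_norm_fourier_le (contDiff_truncatedQuartic hΦ)
    (tsupport_truncatedQuartic_subset hΦ) n
  obtain ⟨C₂, hC₂, h₂⟩ := exists_norm_iteratedFDeriv_slice_sub_le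
    (contDiff_dyadicPowerBlock hΦ) 4 A 2 n
  set v : ℝ := volume.real (Metric.closedBall (0 : EuclideanSpace ℝ (Fin d)) 2) with hv
  have hv0 : 0 ≤ v := measureReal_nonneg
  set C₃ : ℝ := 2 ^ n * ((n + 1) * v) * C₂ with hC₃
  have hC₃0 : 0 ≤ C₃ := by positivity
  -- The summands serve the sup bound, the quartic term (`2 ^ n` from evaluating at `ξ / 2`) and the
  -- block.
  set C₄ : ℝ := v * 2 ^ A + 2 ^ n * C₁ + C₃ with hC₄
  have hC₄0 : 0 ≤ C₄ := by positivity
  -- The `+ 1` only secures strict positivity.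
  refine ⟨3 * C₄ * 2 ^ (d + A) + 1, by positivity, fun a ha haA ξ => ?_⟩
  have ha0 : 0 < a - 4 := by linarith
  have bdd : ∀ ξ, ‖𝓕 (truncatedPowerDiff Φ a) ξ‖ ≤ C₄ * (a - 4) := by
    intro ξ
    have h3 := norm_fourier_le_of_bounded (support_truncatedPowerDiff_subset hΦ a)
      (norm_truncatedPowerDiff_le hΦ ha) ξ
    have h4 : (2 : ℝ) ^ a ≤ 2 ^ A := Real.rpow_le_rpow_of_exponent_le (by norm_num) haA
    calc _ ≤ v * (2 ^ a * (a - 4)) := h3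
      _ ≤ v * (2 ^ A * (a - 4)) := by gcongr
      _ = v * 2 ^ A * (a - 4) := by ring
      _ ≤ _ := by
        gcongr
        have : 0 ≤ 2 ^ n * C₁ := by positivity
        linarith
  have recursion : ∀ ξ : EuclideanSpace ℝ (Fin d), 1 ≤ ‖ξ‖ →
      ‖𝓕 (truncatedPowerDiff Φ a) ξ‖ ≤
        2 ^ (-(d + a)) * ‖𝓕 (truncatedPowerDiff Φ a) ((1 / 2 : ℝ) • ξ)‖ +
          C₄ * (a - 4) * ‖ξ‖ ^ (-(d + a) - 1) := by
    intro ξ hξ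
    have hpos : 0 < ‖ξ‖ := by linarith
    have hpow : (‖ξ‖ ^ n)⁻¹ ≤ ‖ξ‖ ^ (-(d + a) - 1) := by
      rw [← Real.rpow_natCast, ← Real.rpow_neg hpos.le]
      exact Real.rpow_le_rpow_of_exponent_le hξ (by linarith)
    have hquartic : ‖𝓕 (truncatedQuartic Φ) ((1 / 2 : ℝ) • ξ)‖ ≤
        2 ^ n * C₁ * ‖ξ‖ ^ (-(d + a) - 1) := by
      have h3 := h₁ ((1 / 2 : ℝ) • ξ)
      have h4 : ‖(1 / 2 : ℝ) • ξ‖ = ‖ξ‖ / 2 := by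
        rw [norm_smul]
        norm_num
        ring
      rw [h4, div_pow, div_mul_eq_mul_div, div_le_iff₀ (by positivity)] at h3
      calc _ ≤ C₁ * 2 ^ n * (‖ξ‖ ^ n)⁻¹ := by
            rw [← div_eq_mul_inv, le_div_iff₀ (by positivity)]
            linarith
        _ ≤ C₁ * 2 ^ n * ‖ξ‖ ^ (-(d + a) - 1) := by gcongr
        _ = _ := by ring
    have hblock : ‖𝓕 (fun x => dyadicPowerBlock Φ (a, x) - dyadicPowerBlock Φ (4, x)) ξ‖ ≤
        C₃ * (a - 4) * ‖ξ‖ ^ (-(d + a) - 1) := by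
      have hs : ∀ c : ℝ, ContDiff ℝ ∞ (fun x => dyadicPowerBlock Φ (c, x)) := fun c =>
        (contDiff_dyadicPowerBlock hΦ).comp (contDiff_const.prodMk contDiff_id)
      have h3 := pow_mul_norm_fourier_le_of_iteratedFDeriv_le ((hs a).sub (hs 4))
        (tsupport_dyadicPowerBlock_sub_subset hΦ a 4) (h₂ a ha.le haA) ξ
      calc _ ≤ C₃ * (a - 4) * (‖ξ‖ ^ n)⁻¹ := by
            rw [← div_eq_mul_inv, le_div_iff₀ (by positivity), mul_comm, hC₃, mul_assoc _ C₂]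
            exact h3
        _ ≤ _ := by gcongr
    have hd1 : (2 : ℝ) ^ (-(d : ℝ)) ≤ 1 :=
      Real.rpow_le_one_of_one_le_of_nonpos (by norm_num) (by simp)
    have hcoef : |((2 : ℝ) ^ (-a) - 2 ^ (-4 : ℝ)) * 2 ^ (-(d : ℝ))| ≤ a - 4 := by
      rw [abs_mul, abs_of_pos (by positivity : (0 : ℝ) < 2 ^ (-(d : ℝ)))]
      calc _ ≤ (a - 4) * 1 :=
            mul_le_mul (abs_two_rpow_neg_sub_le ha) hd1 (by positivity) ha0.le
        _ = _ := mul_one _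
    have hfirst : (2 : ℝ) ^ (-a) * 2 ^ (-(d : ℝ)) = 2 ^ (-(d + a)) := by
      rw [← Real.rpow_add (by norm_num)]
      ring_nf
    rw [fourier_truncatedPowerDiff_dyadic hΦ ha ξ, hfirst]
    refine (norm_add_le _ _).trans ((add_le_add (norm_add_le _ _) hblock).trans ?_)
    rw [norm_smul, norm_smul, Real.norm_eq_abs, Real.norm_eq_abs,
      abs_of_pos (by positivity : (0 : ℝ) < 2 ^ (-(d + a)))]
    have h5 := mul_le_mul hcoef hquartic (norm_nonneg _) ha0.le
    have h6 : 0 ≤ v * 2 ^ A * (a - 4) * ‖ξ‖ ^ (-(d + a) - 1) := by positivity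
    have h7 : C₄ * (a - 4) * ‖ξ‖ ^ (-(d + a) - 1) =
        v * 2 ^ A * (a - 4) * ‖ξ‖ ^ (-(d + a) - 1) +
        (a - 4) * (2 ^ n * C₁ * ‖ξ‖ ^ (-(d + a) - 1)) +
        C₃ * (a - 4) * ‖ξ‖ ^ (-(d + a) - 1) := by
      rw [hC₄]
      ring
    linarith
  have final := norm_le_of_dyadic_recursion (by positivity) (by positivity) bdd recursion ξ
  have h8 : (2 : ℝ) ^ (d + a) ≤ 2 ^ (d + A) :=
    Real.rpow_le_rpow_of_exponent_le (by norm_num) (by linarith)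
  rw [show -((d : ℝ) + a) = -(d : ℝ) - a by ring] at final
  calc _ ≤ 3 * (C₄ * (a - 4)) * 2 ^ (d + a) * (1 + ‖ξ‖) ^ (-(d : ℝ) - a) := final
    _ ≤ 3 * (C₄ * (a - 4)) * 2 ^ (d + A) * (1 + ‖ξ‖) ^ (-(d : ℝ) - a) := by gcongr
    _ = 3 * C₄ * 2 ^ (d + A) * (a - 4) * (1 + ‖ξ‖) ^ (-(d : ℝ) - a) := by ring
    _ ≤ _ := by
      gcongr
      linarith

end TruncatedPower

theorem lemma5p1 (d : ℕ) (hd : 1 ≤ d) (Φ : EuclideanSpace ℝ (Fin d) → ℝ)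
    (hΦ : IsTruncationFunction Φ) :
    ∃ η : ℝ → ℝ,
      (∀ a : ℝ, 4 < a → 0 < η a ∧
        ∀ ξ : EuclideanSpace ℝ (Fin d),
          ‖𝓕 (truncatedPowerDiff Φ a) ξ‖ ≤ η a * (1 + ‖ξ‖) ^ (-(d : ℝ) - a)) ∧
      η =O[𝓝[>] (4 : ℝ)] (fun a : ℝ => a - 4) := by
  choose C hC hbound using exists_norm_fourier_truncatedPowerDiff_le hΦ
  -- `max a 5` covers every `a > 4` while keeping the constant fixed at `C 5` near `4`.
  refine ⟨fun a => C (max a 5) * (a - 4), fun a ha => ⟨mul_pos (hC _) (by linarith),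
    hbound _ a ha (le_max_left _ _)⟩, ?_⟩
  refine Asymptotics.IsBigO.of_bound (C 5) ?_
  have h1 : Set.Iio (5 : ℝ) ∈ 𝓝[>] (4 : ℝ) :=
    mem_nhdsWithin_of_mem_nhds (Iio_mem_nhds (by norm_num))
  filter_upwards [h1] with a ha
  rw [max_eq_right (le_of_lt ha), norm_mul, Real.norm_eq_abs, abs_of_pos (hC 5)]
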